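/- **Conventions.** A *cartesian bicategory* is a symmetric monoidal category $(\mathcal B,\otimes,I)$ enriched over posets (composition and $\otimes$ are monotone) in which every object $X$ carries a cocommutative comonoid $\Delta_X\colon X\to X\otimes X$, $\varepsilon_X\colon X\to I$, coherent with the monoidal structure, such that $\Delta_X,\varepsilon_X$ have right adjoints $\nabla_X\colon X\otimes X\to X$, $\eta_X\colon I\to X$, the Frobenius law $(\Delta_X\otimes \mathrm{id});(\mathrm{id}\otimes\nabla_X)=\nabla_X;\Delta_X=(\mathrm{id}\otimes\Delta_X);(\nabla_X\otimes \mathrm{id})$ holds, and every $R\colon X\to Y$ is a lax comonoid homomorphism: $R;\Delta_Y\le\Delta_X;(R\otimes R)$ and $R;\varepsilon_Y\le\varepsilon_X$. A *map* is a morphism for which both are equalities. The maps form a category $\mathrm{Map}(\mathcal B)$ with finite products $\otimes, I$. Every hom-poset of $\mathcal B$ is an inf-semilattice, with $R\wedge S=\Delta_X;(R\otimes S);\nabla_Y$ and $\top=\varepsilon_X;\eta_Y$, and $R(\mathcal B)$ is the functor $\mathrm{Hom}_{\mathcal B}(-,I)\colon\mathrm{Map}(\mathcal B)^{op}\to\mathrm{InfSL}$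 acting by precomposition. An *elementary existential doctrine* is a functor $P\colon\mathcal C^{op}\to\mathrm{InfSL}$ on a category with finite products such that: (i) for every $A$ there is $\delta_A\in P(A\times A)$ such that for every $X$ the assignment $\alpha\mapsto P_{\langle\pi_1,\pi_2\rangle}(\alpha)\wedge P_{\langle\pi_2,\pi_3\rangle}(\delta_A)$ is left adjoint to $P_{\mathrm{id}_X\times\Delta_A}\colon P(X\times A\times A)\to P(X\times A)$; (ii) $P_\pi$ has a left adjoint $\exists_\pi$ for every product projection $\pi$, satisfying the Beck–Chevalley condition $\exists_{\pi'}P_{f'}=P_f\exists_\pi$ for every pullback $\pi'$ of a projection $\pi\colon X\times A\to A$ along $f\colon A'\to A$ (with $f'$ the other projection of the pullback), and Frobenius reciprocity $\exists_\pi(P_\pi(\alpha)\wedge\beta)=\alpha\wedge\exists_\pi(\beta)$ for $\alpha\in P(A)$, $\beta\in P(X\times A)$. For such $P$, let $\mathcal A_P$ have the objects of $\mathcal C$, hom-posets $\mathcal A_P(X,Y)=P(X\times Y)$, identities $\delta_X$, composition $f;g=\exists_{\pi_{XZ}}(P_{\pi_{XY}}(f)\wedge P_{\pi_{YZ}}(g))$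 and tensor $f\otimes g=P_{\langle\pi_1,\pi_3\rangle}(f)\wedge P_{\langle\pi_2,\pi_4\rangle}(g)$. Its graph functor $\Gamma_P\colon\mathcal C\to\mathcal A_P$ is the identity on objects, with $\Gamma_P(f)=P_{f\times\mathrm{id}_Y}(\delta_Y)$ for $f\colon X\to Y$; the structural isomorphisms and comonoids of $\mathcal A_P$ are the images under $\Gamma_P$ of those of $\mathcal C$, and maps in $\mathcal A_P$ are the homomorphisms for these comonoids. The doctrine $P$ *has comprehensive diagonals* if, for every $A$, $\top\le P_{\Delta_A}(\delta_A)$ and every $h\colon Z\to A\times A$ with $\top\le P_h(\delta_A)$ factors uniquely through $\Delta_A$. It satisfies the *Rule of Unique Choice* if for every $R\in P(X\times Y)$ that is a map in $\mathcal A_P$ there is $f\colon X\to Y$ in $\mathcal C$ with $\top\le P_{\langle\mathrm{id}_X,f\rangle}(R)$. **Proposition.** Let $\mathcal B$ be a cartesian bicategory. Then $R(\mathcal B)$ is an elementary existential doctrine that has comprehensive diagonals and satisfies the Rule of Unique Choice. Moreover, define, identically on objects, $\epsilon_{\mathcal B}^{-1}\colon\mathcal B\to\mathcal A_{R(\mathcal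 B)}$ by $\epsilon_{\mathcal B}^{-1}(S)=(S\otimes\mathrm{id}_Y);\nabla_Y;\varepsilon_Y$ for $S\colon X\to Y$, and $\epsilon_{\mathcal B}\colon\mathcal A_{R(\mathcal B)}\to\mathcal B$ by sending $R\colon X\otimes Y\to I$ to $(\mathrm{id}_X\otimes(\eta_Y;\Delta_Y));(R\otimes\mathrm{id}_Y)\colon X\to Y$ (up to unitors and associators). These are mutually inverse isomorphisms: they are order isomorphisms on hom-posets, and $\epsilon_{\mathcal B}^{-1}$ preserves identities, composition and $\otimes$. For every map $f$ of $\mathcal B$ one has $\Gamma_{R(\mathcal B)}(f)=\epsilon_{\mathcal B}^{-1}(f)$ (so that $\epsilon_{\mathcal B}^{-1}$ also preserves the structural isomorphisms and the comonoids), and $\Gamma_{R(\mathcal B)}$ is full and faithful as a functor $\mathrm{Map}(\mathcal B)\to\mathrm{Map}(\mathcal A_{R(\mathcal B)})$. -/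

import Mathlib

open CategoryTheory MonoidalCategory Opposite
open scoped ComonObj

universe v u w v' u'

/-- A cartesian bicategory: a symmetric monoidal category, enriched over posets, in which every
object carries a cocommutative comonoid structure `Δ`, `ε`, coherent with the monoidal structure
(all this is `CopyDiscardCategory`), such that `Δ` and `ε` have right adjoints `mul` and `unit`,
the Frobenius law holds and every morphism is a lax comonoid homomorphism. -/
class CartesianBicategory (B : Type u) [Category.{v} B] [MonoidalCategory.{v} B] extends
    CopyDiscardCategory B where
  /-- The hom-sets are partially ordered. -/
  [homOrder : ∀ X Y : B, PartialOrder (X ⟶ Y)]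
  comp_mono {X Y Z : B} {f f' : X ⟶ Y} {g g' : Y ⟶ Z} :
    f ≤ f' → g ≤ g' → f ≫ g ≤ f' ≫ g'
  tensor_mono {X Y X' Y' : B} {f f' : X ⟶ Y} {g g' : X' ⟶ Y'} :
    f ≤ f' → g ≤ g' → (f ⊗ₘ g) ≤ (f' ⊗ₘ g')
  /-- The right adjoint of the comultiplication. -/
  mul (X : B) : X ⊗ X ⟶ X
  /-- The right adjoint of the counit. -/
  unit (X : B) : 𝟙_ B ⟶ X
  le_copy_mul (X : B) : 𝟙 X ≤ Δ[X] ≫ mul X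
  mul_copy_le (X : B) : mul X ≫ Δ[X] ≤ 𝟙 (X ⊗ X)
  le_discard_unit (X : B) : 𝟙 X ≤ ε[X] ≫ unit X
  unit_discard_le (X : B) : unit X ≫ ε[X] ≤ 𝟙 (𝟙_ B)
  frobenius_left (X : B) : Δ[X] ▷ X ≫ (α_ X X X).hom ≫ X ◁ mul X = mul X ≫ Δ[X]
  frobenius_right (X : B) : X ◁ Δ[X] ≫ (α_ X X X).inv ≫ mul X ▷ X = mul X ≫ Δ[X]
  lax_copy {X Y : B} (R : X ⟶ Y) : R ≫ Δ[Y] ≤ Δ[X] ≫ (R ⊗ₘ R)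
  lax_discard {X Y : B} (R : X ⟶ Y) : R ≫ ε[Y] ≤ ε[X]

attribute [reducible] CartesianBicategory.homOrder
attribute [instance] CartesianBicategory.homOrder

/-! ### Elementary existential doctrines -/

section Doctrine

open CartesianMonoidalCategory

variable {C : Type u'} [Category.{v'} C] [CartesianMonoidalCategory C]

/-- The diagonal `A ⟶ A × A` in a cartesian category. -/
abbrev diagonal (A : C) : A ⟶ A ⊗ A := lift (𝟙 A) (𝟙 A)

/-- The action `P_f : P(Y) → P(X)` of a doctrine `P` on `f : X ⟶ Y`. -/
def reindex (P : Cᵒᵖ ⥤ SemilatInfCat.{w}) {X Y : C} (f : X ⟶ Y) :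
    InfTopHom (P.obj (op Y)) (P.obj (op X)) :=
  P.map f.op

/-- The structure making a functor `P : Cᵒᵖ ⥤ InfSL` an elementary existential doctrine: the
equality predicates `δ A ∈ P(A × A)` and the left adjoints to reindexing along projections. All
of it is uniquely determined by `P`. -/
structure ElementaryExistential (P : Cᵒᵖ ⥤ SemilatInfCat.{w}) where
  /-- The equality predicate on `A`. -/
  δ (A : C) : P.obj (op (A ⊗ A))
  /-- `α ↦ P_⟨π₁,π₂⟩(α) ⊓ P_⟨π₂,π₃⟩(δ_A)` is left adjoint to `P_e` for `e = id_X × Δ_A`. -/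
  elementary (X A : C) :
    GaloisConnection
      (fun α : P.obj (op (X ⊗ A)) =>
        reindex P (X ◁ fst A A) α ⊓ reindex P (snd X (A ⊗ A)) (δ A))
      (reindex P (X ◁ diagonal A))
  /-- The left adjoint to reindexing along the first projection `A₁ × A₂ ⟶ A₁`. -/
  existsFst (A₁ A₂ : C) : P.obj (op (A₁ ⊗ A₂)) → P.obj (op A₁)
  gc_existsFst (A₁ A₂ : C) : GaloisConnection (existsFst A₁ A₂) (reindex P (fst A₁ A₂))
  /-- The left adjoint to reindexing along the second projection `A₁ × A₂ ⟶ A₂`. -/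
  existsSnd (A₁ A₂ : C) : P.obj (op (A₁ ⊗ A₂)) → P.obj (op A₂)
  gc_existsSnd (A₁ A₂ : C) : GaloisConnection (existsSnd A₁ A₂) (reindex P (snd A₁ A₂))
  /-- For every pullback `π'` of a projection `X × A ⟶ A` along some `f`, the left adjoint
  to `P_π'` exists and satisfies the Beck-Chevalley condition. -/
  beckChevalley {X A X' A' : C} (f' : X' ⟶ X ⊗ A) (π' : X' ⟶ A') (f : A' ⟶ A) :
    IsPullback π' f' f (snd X A) →
      ∃ ex : P.obj (op X') → P.obj (op A'), GaloisConnection ex (reindex P π') ∧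
        ∀ β : P.obj (op (X ⊗ A)), ex (reindex P f' β) = reindex P f (existsSnd X A β)
  /-- Frobenius reciprocity. -/
  frobenius (X A : C) (α : P.obj (op A)) (β : P.obj (op (X ⊗ A))) :
    existsSnd X A (reindex P (snd X A) α ⊓ β) = α ⊓ existsSnd X A β

namespace ElementaryExistential

variable {P : Cᵒᵖ ⥤ SemilatInfCat.{w}} (S : ElementaryExistential P)

/-! The cartesian bicategory `A_P` of relations of the doctrine: its objects are those of `C`, and
its hom-posets are `Hom(X, Y) = P(X × Y)`. -/

/-- The hom-posets of `A_P`. -/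
abbrev Rel (_ : ElementaryExistential P) (X Y : C) : Type w := P.obj (op (X ⊗ Y))

/-- The identities of `A_P`. -/
def relId (X : C) : S.Rel X X := S.δ X

/-- Composition `f ; g = ∃_Y (P_{XY}(f) ⊓ P_{YZ}(g))` in `A_P`; the quantified factor is listed
first, that is, `X × Y × Z` is written as `Y × (X × Z)`. -/
def relComp {X Y Z : C} (f : S.Rel X Y) (g : S.Rel Y Z) : S.Rel X Z :=
  S.existsSnd Y (X ⊗ Z)
    (reindex P (lift (snd Y (X ⊗ Z) ≫ fst X Z) (fst Y (X ⊗ Z))) f ⊓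
      reindex P (lift (fst Y (X ⊗ Z)) (snd Y (X ⊗ Z) ≫ snd X Z)) g)

/-- The tensor product `P_⟨π₁,π₃⟩(f) ⊓ P_⟨π₂,π₄⟩(g)` of morphisms of `A_P`. -/
def relTensor {X Y X' Y' : C} (f : S.Rel X Y) (g : S.Rel X' Y') :
    S.Rel (X ⊗ X') (Y ⊗ Y') :=
  reindex P (fst X X' ⊗ₘ fst Y Y') f ⊓ reindex P (snd X X' ⊗ₘ snd Y Y') g

/-- The graph functor `Γ_P : C → A_P`. It is the identity on objects, and it transports the
structural isomorphisms and the comonoids of `C` to `A_P`. -/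
def graph {X Y : C} (f : X ⟶ Y) : S.Rel X Y := reindex P (f ▷ Y) (S.δ Y)

/-- `R` is a map in `A_P`, that is, a homomorphism for the comonoids `Γ_P(Δ)`, `Γ_P(!)`. -/
def IsMap {X Y : C} (R : S.Rel X Y) : Prop :=
  S.relComp R (S.graph (diagonal Y)) =
      S.relComp (S.graph (diagonal X)) (S.relTensor R R) ∧
    S.relComp R (S.graph (toUnit Y)) = S.graph (toUnit X)

end ElementaryExistential

/-- `c : X ⟶ A` is a comprehension of `α ∈ P(A)`. -/
def IsComprehension (P : Cᵒᵖ ⥤ SemilatInfCat.{w}) {X A : C} (c : X ⟶ A) (α : P.obj (op A)) :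
    Prop :=
  ⊤ ≤ reindex P c α ∧ ∀ (Z : C) (h : Z ⟶ A), ⊤ ≤ reindex P h α → ∃! h' : Z ⟶ X, h = h' ≫ c

namespace ElementaryExistential

variable {P : Cᵒᵖ ⥤ SemilatInfCat.{w}} (S : ElementaryExistential P)

/-- Every diagonal is the comprehension of the corresponding equality predicate. -/
def HasComprehensiveDiagonals : Prop := ∀ A : C, IsComprehension P (diagonal A) (S.δ A)

/-- The Rule of Unique Choice. -/
def RuleOfUniqueChoice : Prop :=
  ∀ (X Y : C) (R : S.Rel X Y), S.IsMap R → ∃ f : X ⟶ Y, ⊤ ≤ reindex P (lift (𝟙 X) f) R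

end ElementaryExistential

end Doctrine

/-! ### Maps of a cartesian bicategory and the associated doctrine -/

namespace CartesianBicategory

variable {B : Type u} [Category.{v} B] [MonoidalCategory.{v} B] [CartesianBicategory B]

theorem le_unit {X Y : B} (R : X ⟶ Y) : R ≤ ε[X] ≫ unit Y := by
  calc R = R ≫ 𝟙 Y := (Category.comp_id R).symm
    _ ≤ R ≫ ε[Y] ≫ unit Y := comp_mono le_rfl (le_discard_unit Y)
    _ = (R ≫ ε[Y]) ≫ unit Y := (Category.assoc _ _ _).symm
    _ ≤ ε[X] ≫ unit Y := comp_mono (lax_discard R) le_rfl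

theorem unit_mul_right_le (Y : B) : (𝟙 Y ⊗ₘ unit Y) ≫ mul Y ≤ (ρ_ Y).hom := by
  have h : Δ[Y] ≫ (𝟙 Y ⊗ₘ ε[Y]) ≫ (ρ_ Y).hom = 𝟙 Y := by simp
  calc (𝟙 Y ⊗ₘ unit Y) ≫ mul Y
      = (𝟙 Y ⊗ₘ unit Y) ≫ (mul Y ≫ Δ[Y]) ≫ (𝟙 Y ⊗ₘ ε[Y]) ≫ (ρ_ Y).hom := by
        simp only [Category.assoc, h, Category.comp_id]
    _ ≤ (𝟙 Y ⊗ₘ unit Y) ≫ 𝟙 (Y ⊗ Y) ≫ (𝟙 Y ⊗ₘ ε[Y]) ≫ (ρ_ Y).hom :=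
        comp_mono le_rfl (comp_mono (mul_copy_le Y) le_rfl)
    _ = (𝟙 Y ⊗ₘ (unit Y ≫ ε[Y])) ≫ (ρ_ Y).hom := by simp
    _ ≤ (𝟙 Y ⊗ₘ 𝟙 (𝟙_ B)) ≫ (ρ_ Y).hom :=
        comp_mono (tensor_mono le_rfl (unit_discard_le Y)) le_rfl
    _ = (ρ_ Y).hom := by simp

theorem unit_mul_left_le (Y : B) : (unit Y ⊗ₘ 𝟙 Y) ≫ mul Y ≤ (λ_ Y).hom := by
  have h : Δ[Y] ≫ (ε[Y] ⊗ₘ 𝟙 Y) ≫ (λ_ Y).hom = 𝟙 Y := by simp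
  calc (unit Y ⊗ₘ 𝟙 Y) ≫ mul Y
      = (unit Y ⊗ₘ 𝟙 Y) ≫ (mul Y ≫ Δ[Y]) ≫ (ε[Y] ⊗ₘ 𝟙 Y) ≫ (λ_ Y).hom := by
        simp only [Category.assoc, h, Category.comp_id]
    _ ≤ (unit Y ⊗ₘ 𝟙 Y) ≫ 𝟙 (Y ⊗ Y) ≫ (ε[Y] ⊗ₘ 𝟙 Y) ≫ (λ_ Y).hom :=
        comp_mono le_rfl (comp_mono (mul_copy_le Y) le_rfl)
    _ = ((unit Y ≫ ε[Y]) ⊗ₘ 𝟙 Y) ≫ (λ_ Y).hom := by simp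
    _ ≤ (𝟙 (𝟙_ B) ⊗ₘ 𝟙 Y) ≫ (λ_ Y).hom :=
        comp_mono (tensor_mono (unit_discard_le Y) le_rfl) le_rfl
    _ = (λ_ Y).hom := by simp

/-- Hom-posets are inf-semilattices, with `R ⊓ S = Δ ; (R ⊗ S) ; mul`. -/
instance homSemilatticeInf (X Y : B) : SemilatticeInf (X ⟶ Y) where
  inf R S := Δ[X] ≫ (R ⊗ₘ S) ≫ mul Y
  inf_le_left R S := by
    calc Δ[X] ≫ (R ⊗ₘ S) ≫ mul Y
        ≤ Δ[X] ≫ (R ⊗ₘ (ε[X] ≫ unit Y)) ≫ mul Y :=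
          comp_mono le_rfl (comp_mono (tensor_mono le_rfl (le_unit S)) le_rfl)
      _ = Δ[X] ≫ (R ⊗ₘ ε[X]) ≫ (𝟙 Y ⊗ₘ unit Y) ≫ mul Y := by
          rw [MonoidalCategory.tensorHom_comp_tensorHom_assoc, Category.comp_id]
      _ ≤ Δ[X] ≫ (R ⊗ₘ ε[X]) ≫ (ρ_ Y).hom :=
          comp_mono le_rfl (comp_mono le_rfl (unit_mul_right_le Y))
      _ = R := by simp
  inf_le_right R S := by
    calc Δ[X] ≫ (R ⊗ₘ S) ≫ mul Y
        ≤ Δ[X] ≫ ((ε[X] ≫ unit Y) ⊗ₘ S) ≫ mul Y :=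
          comp_mono le_rfl (comp_mono (tensor_mono (le_unit R) le_rfl) le_rfl)
      _ = Δ[X] ≫ (ε[X] ⊗ₘ S) ≫ (unit Y ⊗ₘ 𝟙 Y) ≫ mul Y := by
          rw [MonoidalCategory.tensorHom_comp_tensorHom_assoc, Category.comp_id]
      _ ≤ Δ[X] ≫ (ε[X] ⊗ₘ S) ≫ (λ_ Y).hom :=
          comp_mono le_rfl (comp_mono le_rfl (unit_mul_left_le Y))
      _ = S := by simp
  le_inf T R S hR hS := by
    calc T = T ≫ 𝟙 Y := (Category.comp_id T).symm
      _ ≤ T ≫ Δ[Y] ≫ mul Y := comp_mono le_rfl (le_copy_mul Y)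
      _ = (T ≫ Δ[Y]) ≫ mul Y := (Category.assoc _ _ _).symm
      _ ≤ (Δ[X] ≫ (T ⊗ₘ T)) ≫ mul Y := comp_mono (lax_copy T) le_rfl
      _ = Δ[X] ≫ (T ⊗ₘ T) ≫ mul Y := Category.assoc _ _ _
      _ ≤ Δ[X] ≫ (R ⊗ₘ S) ≫ mul Y :=
          comp_mono le_rfl (comp_mono (tensor_mono hR hS) le_rfl)

instance homOrderTop (X Y : B) : OrderTop (X ⟶ Y) where
  top := ε[X] ≫ unit Y
  le_top := le_unit

theorem inf_def {X Y : B} (R S : X ⟶ Y) : R ⊓ S = Δ[X] ≫ (R ⊗ₘ S) ≫ mul Y := rfl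

theorem top_def (X Y : B) : (⊤ : X ⟶ Y) = ε[X] ≫ unit Y := rfl

theorem isComonHom_of_adj {X Y : B} (f : X ⟶ Y) (g : Y ⟶ X) (h₁ : 𝟙 X ≤ f ≫ g)
    (h₂ : g ≫ f ≤ 𝟙 Y) : IsComonHom f where
  hom_counit := by
    refine le_antisymm (lax_discard f) ?_
    calc ε[X] = 𝟙 X ≫ ε[X] := (Category.id_comp _).symm
      _ ≤ (f ≫ g) ≫ ε[X] := comp_mono h₁ le_rfl
      _ = f ≫ g ≫ ε[X] := Category.assoc _ _ _
      _ ≤ f ≫ ε[Y] := comp_mono le_rfl (lax_discard g)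
  hom_comul := by
    refine le_antisymm (lax_copy f) ?_
    calc Δ[X] ≫ (f ⊗ₘ f) = 𝟙 X ≫ Δ[X] ≫ (f ⊗ₘ f) := (Category.id_comp _).symm
      _ ≤ (f ≫ g) ≫ Δ[X] ≫ (f ⊗ₘ f) := comp_mono h₁ le_rfl
      _ = f ≫ (g ≫ Δ[X]) ≫ (f ⊗ₘ f) := by simp only [Category.assoc]
      _ ≤ f ≫ (Δ[Y] ≫ (g ⊗ₘ g)) ≫ (f ⊗ₘ f) :=
          comp_mono le_rfl (comp_mono (lax_copy g) le_rfl)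
      _ = f ≫ Δ[Y] ≫ ((g ≫ f) ⊗ₘ (g ≫ f)) := by simp
      _ ≤ f ≫ Δ[Y] ≫ (𝟙 Y ⊗ₘ 𝟙 Y) :=
          comp_mono le_rfl (comp_mono le_rfl (tensor_mono h₂ h₂))
      _ = f ≫ Δ[Y] := by simp

theorem isComonHom_of_inv {X Y : B} (f : X ⟶ Y) (g : Y ⟶ X) (h₁ : f ≫ g = 𝟙 X)
    (h₂ : g ≫ f = 𝟙 Y) : IsComonHom f :=
  isComonHom_of_adj f g h₁.ge h₂.le

variable (B) in
/-- The maps of a cartesian bicategory: the (strict) comonoid homomorphisms. -/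
def maps : MorphismProperty B := fun _ _ f => IsComonHom f

instance : (maps B).IsMultiplicative where
  id_mem X := (inferInstance : IsComonHom (𝟙 X))
  comp_mem f g hf hg :=
    have : IsComonHom f := hf
    have : IsComonHom g := hg
    (inferInstance : IsComonHom (f ≫ g))

theorem maps_tensor {X Y X' Y' : B} (f : X ⟶ Y) (g : X' ⟶ Y') (hf : maps B f)
    (hg : maps B g) : maps B (f ⊗ₘ g) := by
  refine @IsComonHom.mk _ _ _ _ _ (_) (_) _ ?_ ?_
  · rw [CopyDiscardCategory.discard_tensor, CopyDiscardCategory.discard_tensor,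
      MonoidalCategory.tensorHom_comp_tensorHom_assoc, hf.hom_counit, hg.hom_counit]
  · rw [CopyDiscardCategory.copy_tensor, CopyDiscardCategory.copy_tensor,
      MonoidalCategory.tensorHom_comp_tensorHom_assoc, hf.hom_comul, hg.hom_comul,
      Category.assoc, ← tensorμ_natural, MonoidalCategory.tensorHom_comp_tensorHom_assoc]

instance : (maps B).IsStableUnderBraiding where
  whiskerLeft X _ _ f hf := by
    rw [← id_tensorHom]; exact maps_tensor _ _ ((maps B).id_mem X) hf
  whiskerRight f hf Y := by
    rw [← tensorHom_id]; exact maps_tensor _ _ hf ((maps B).id_mem Y)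
  associator_hom_mem X Y Z :=
    isComonHom_of_inv _ (α_ X Y Z).inv (α_ X Y Z).hom_inv_id (α_ X Y Z).inv_hom_id
  associator_inv_mem X Y Z :=
    isComonHom_of_inv _ (α_ X Y Z).hom (α_ X Y Z).inv_hom_id (α_ X Y Z).hom_inv_id
  leftUnitor_hom_mem X :=
    isComonHom_of_inv _ (λ_ X).inv (λ_ X).hom_inv_id (λ_ X).inv_hom_id
  leftUnitor_inv_mem X :=
    isComonHom_of_inv _ (λ_ X).hom (λ_ X).inv_hom_id (λ_ X).hom_inv_id
  rightUnitor_hom_mem X :=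
    isComonHom_of_inv _ (ρ_ X).inv (ρ_ X).hom_inv_id (ρ_ X).inv_hom_id
  rightUnitor_inv_mem X :=
    isComonHom_of_inv _ (ρ_ X).hom (ρ_ X).inv_hom_id (ρ_ X).hom_inv_id
  braiding_hom_mem X Y :=
    isComonHom_of_inv _ (β_ X Y).inv (β_ X Y).hom_inv_id (β_ X Y).inv_hom_id
  braiding_inv_mem X Y :=
    isComonHom_of_inv _ (β_ X Y).hom (β_ X Y).inv_hom_id (β_ X Y).hom_inv_id

theorem maps_copy (X : B) : maps B Δ[X] :=
  isComonHom_of_adj _ (mul X) (le_copy_mul X) (mul_copy_le X)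

theorem maps_discard (X : B) : maps B ε[X] :=
  isComonHom_of_adj _ (unit X) (le_discard_unit X) (unit_discard_le X)

variable (B) in
/-- The category `Map(B)` of maps of `B`, with the monoidal structure inherited from `B`. -/
abbrev MapCat : Type u := WideSubcategory (maps B)

theorem copy_proj (X Y : B) :
    (CopyDiscardCategory.comonObj (X ⊗ Y)).comul ≫ ((X ◁ ε[Y] ≫ (ρ_ X).hom) ⊗ₘ (ε[X] ▷ Y ≫ (λ_ Y).hom)) = 𝟙 (X ⊗ Y) := by
  rw [CopyDiscardCategory.copy_tensor, ← id_tensorHom, ← tensorHom_id, Category.assoc,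
    ← MonoidalCategory.tensorHom_comp_tensorHom, ← tensorμ_natural_assoc,
    MonoidalCategory.tensorHom_comp_tensorHom_assoc]
  simp
  simp only [tensorμ, braiding_tensorUnit_left]
  monoidal

instance : CartesianMonoidalCategory (MapCat B) where
  isTerminalTensorUnit := Limits.IsTerminal.ofUniqueHom
    (fun X => ⟨ε[X.obj], maps_discard X.obj⟩) (fun X f => by
      ext
      have h : IsComonHom f.hom := f.property
      have h' := h.hom_counit
      change f.hom ≫ (CopyDiscardCategory.comonObj (𝟙_ B)).counit = _ at h'
      rw [CopyDiscardCategory.discard_unit] at h'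
      exact (Category.comp_id _).symm.trans h')
  fst X Y := X ◁ (⟨ε[Y.obj], maps_discard Y.obj⟩ : Y ⟶ 𝟙_ (MapCat B)) ≫ (ρ_ X).hom
  snd X Y := (⟨ε[X.obj], maps_discard X.obj⟩ : X ⟶ 𝟙_ (MapCat B)) ▷ Y ≫ (λ_ Y).hom
  fst_def X Y := rfl
  snd_def X Y := rfl
  tensorProductIsBinaryProduct X Y := Limits.BinaryFan.IsLimit.mk _
    (fun {T} f g => (⟨Δ[T.obj], maps_copy T.obj⟩ : T ⟶ T ⊗ T) ≫ (f ⊗ₘ g))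
    (fun {T} f g => by
      ext
      change (Δ[T.obj] ≫ (f.hom ⊗ₘ g.hom)) ≫ X.obj ◁ ε[Y.obj] ≫ (ρ_ X.obj).hom = f.hom
      have h : g.hom ≫ ε[Y.obj] = ε[T.obj] := IsComonHom.hom_counit (self := g.property)
      rw [Category.assoc, ← id_tensorHom, tensorHom_comp_tensorHom_assoc, h]
      simp)
    (fun {T} f g => by
      ext
      change (Δ[T.obj] ≫ (f.hom ⊗ₘ g.hom)) ≫ ε[X.obj] ▷ Y.obj ≫ (λ_ Y.obj).hom = g.hom
      have h : f.hom ≫ ε[X.obj] = ε[T.obj] := IsComonHom.hom_counit (self := f.property)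
      rw [Category.assoc, ← tensorHom_id, tensorHom_comp_tensorHom_assoc, h]
      simp)
    (fun {T} f g m hf hg => by
      subst hf hg
      ext
      change m.hom = Δ[T.obj] ≫ ((m.hom ≫ X.obj ◁ ε[Y.obj] ≫ (ρ_ X.obj).hom) ⊗ₘ
        (m.hom ≫ ε[X.obj] ▷ Y.obj ≫ (λ_ Y.obj).hom))
      have h : m.hom ≫ (CopyDiscardCategory.comonObj (X.obj ⊗ Y.obj)).comul =
        Δ[T.obj] ≫ (m.hom ⊗ₘ m.hom) := IsComonHom.hom_comul (self := m.property)
      rw [← MonoidalCategory.tensorHom_comp_tensorHom, ← Category.assoc, ← h, Category.assoc,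
        copy_proj]
      exact (Category.comp_id m.hom).symm)

variable (B) in
/-- The doctrine `R(B) = Hom_B(-, I)` on `Map(B)ᵒᵖ`. -/
def doctrine : (MapCat B)ᵒᵖ ⥤ SemilatInfCat.{v} where
  obj X := SemilatInfCat.of (X.unop.obj ⟶ 𝟙_ B)
  map {X Y} f :=
    { toFun := fun U => f.unop.hom ≫ U
      map_inf' := fun U V => by
        have h : f.unop.hom ≫ Δ[X.unop.obj] = Δ[Y.unop.obj] ≫ (f.unop.hom ⊗ₘ f.unop.hom) :=
          IsComonHom.hom_comul (self := f.unop.property)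
        change f.unop.hom ≫ (U ⊓ V) = (f.unop.hom ≫ U) ⊓ (f.unop.hom ≫ V)
        rw [inf_def, inf_def, ← MonoidalCategory.tensorHom_comp_tensorHom, ← Category.assoc, h]
        simp only [Category.assoc]
      map_top' := by
        have h : f.unop.hom ≫ ε[X.unop.obj] = ε[Y.unop.obj] :=
          IsComonHom.hom_counit (self := f.unop.property)
        change f.unop.hom ≫ (⊤ : X.unop.obj ⟶ 𝟙_ B) = ⊤
        rw [top_def, top_def, ← Category.assoc, h] }
  map_id X := by
    apply InfTopHom.ext
    intro U
    exact Category.id_comp (X := X.unop.obj) U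
  map_comp f g := by
    apply InfTopHom.ext
    intro U
    exact Category.assoc g.unop.hom f.unop.hom U

/-- The action of `ε_B : A_{R(B)} → B` on morphisms: bending the second input of
`R : X ⊗ Y ⟶ I` to an output. -/
def counitHom {X Y : MapCat B} (R : (doctrine B).obj (op (X ⊗ Y))) : X.obj ⟶ Y.obj :=
  (ρ_ X.obj).inv ≫ X.obj ◁ (unit Y.obj ≫ Δ[Y.obj]) ≫ (α_ X.obj Y.obj Y.obj).inv ≫
    (show X.obj ⊗ Y.obj ⟶ 𝟙_ B from R) ▷ Y.obj ≫ (λ_ Y.obj).hom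

/-- The action of `ε_B⁻¹ : B → A_{R(B)}` on morphisms: bending the output of `S : X ⟶ Y` to
an input. -/
def counitInvHom {X Y : MapCat B} (S : X.obj ⟶ Y.obj) : (doctrine B).obj (op (X ⊗ Y)) :=
  show X.obj ⊗ Y.obj ⟶ 𝟙_ B from S ▷ Y.obj ≫ mul Y.obj ≫ ε[Y.obj]

end CartesianBicategory

/-! The Frobenius law makes every object self-dual: `unit ≫ Δ` is a cup, `mul ≫ ε` a cap, and they
satisfy the snake equations (`snake_right`, `snake_left`). Bending a wire therefore identifies the
hom-posets `X ⟶ Y` and `X ⊗ Y ⟶ 𝟙_ B`, and bending is monotone both ways.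

The adjoints required of the doctrine already live in `B`. If `f ⊣ g` in `B`, precomposition with
`g` is left adjoint to precomposition with `f` (`gc_of_adj`). Since `ε ⊣ unit`, quantifying a
variable means plugging `unit` into its wire; since `Δ ⊣ mul`, the left adjoint to reindexing along
`X ◁ Δ` is precomposition with `X ◁ mul`, and the Frobenius law identifies it with the meet against
the cap (`fst_inf_eqPred`). So equality is the cap.

Equality predicates and quantifiers are determined by the doctrine, so these formulas hold for every
structure `S`. Composing relations then means joining two wires by a cup (`relComp_eq`), and bending
preserves composition, tensor and graphs. It thus matches maps of `B` with maps of the relational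
bicategory, so the graph functor is full and faithful. In any elementary existential doctrine,
faithfulness of graphs yields comprehensive diagonals and fullness yields unique choice. -/

namespace CartesianBicategory

open CartesianMonoidalCategory

variable {B : Type u} [Category.{v} B] [MonoidalCategory.{v} B] [CartesianBicategory B]

/-! ### Adjunctions in `B` and the coherence of `mul` and `unit` -/

/-- Right adjoints in a cartesian bicategory are unique. -/
theorem rightAdjoint_unique {X Y : B} {f : X ⟶ Y} {g g' : Y ⟶ X} (h₁ : 𝟙 X ≤ f ≫ g)
    (h₂ : g ≫ f ≤ 𝟙 Y) (h₁' : 𝟙 X ≤ f ≫ g') (h₂' : g' ≫ f ≤ 𝟙 Y) : g = g' := by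
  have key : ∀ {k k' : Y ⟶ X}, k ≫ f ≤ 𝟙 Y → 𝟙 X ≤ f ≫ k' → k ≤ k' := fun {k k'} hk hk' =>
    calc k = k ≫ 𝟙 X := (Category.comp_id k).symm
      _ ≤ k ≫ f ≫ k' := comp_mono le_rfl hk'
      _ = (k ≫ f) ≫ k' := (Category.assoc _ _ _).symm
      _ ≤ 𝟙 Y ≫ k' := comp_mono hk le_rfl
      _ = k' := Category.id_comp k'
  exact le_antisymm (key h₂ h₁') (key h₂' h₁)

/-- Precomposition is contravariant, so it exchanges the two adjoints. This is the source of every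
left adjoint of the doctrine. -/
theorem gc_of_adj {X Y : B} {f : X ⟶ Y} {g : Y ⟶ X} (h₁ : 𝟙 X ≤ f ≫ g)
    (h₂ : g ≫ f ≤ 𝟙 Y) (Z : B) :
    GaloisConnection (fun U : X ⟶ Z => g ≫ U) (fun V : Y ⟶ Z => f ≫ V) := by
  intro U V
  constructor
  · intro h
    calc U = 𝟙 X ≫ U := (Category.id_comp U).symm
      _ ≤ (f ≫ g) ≫ U := comp_mono h₁ le_rfl
      _ = f ≫ g ≫ U := Category.assoc _ _ _
      _ ≤ f ≫ V := comp_mono le_rfl h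
  · intro h
    calc g ≫ U ≤ g ≫ f ≫ V := comp_mono le_rfl h
      _ = (g ≫ f) ≫ V := (Category.assoc _ _ _).symm
      _ ≤ 𝟙 Y ≫ V := comp_mono h₂ le_rfl
      _ = V := Category.id_comp V

theorem whiskerLeft_mono (X : B) {Y Z : B} {f g : Y ⟶ Z} (h : f ≤ g) : X ◁ f ≤ X ◁ g := by
  rw [← id_tensorHom, ← id_tensorHom]; exact tensor_mono le_rfl h

theorem whiskerRight_mono {Y Z : B} {f g : Y ⟶ Z} (h : f ≤ g) (X : B) : f ▷ X ≤ g ▷ X := by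
  rw [← tensorHom_id, ← tensorHom_id]; exact tensor_mono h le_rfl

theorem mul_tensorUnit : mul (𝟙_ B) = (λ_ (𝟙_ B)).hom := by
  have h : Δ[𝟙_ B] = (λ_ (𝟙_ B)).inv := by
    have := CopyDiscardCategory.copy_unit (C := B); exact this
  refine rightAdjoint_unique (le_copy_mul _) (mul_copy_le _) ?_ ?_ <;> rw [h] <;> simp

/-- By cocommutativity, the braided multiplication is again right adjoint to `Δ`. -/
theorem braiding_mul (X : B) : (β_ X X).hom ≫ mul X = mul X := by
  have h : Δ[X] ≫ (β_ X X).hom = Δ[X] := IsCommComonObj.comul_comm X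
  refine rightAdjoint_unique (f := Δ[X]) ?_ ?_ (le_copy_mul X) (mul_copy_le X)
  · rw [← Category.assoc, h]; exact le_copy_mul X
  · calc ((β_ X X).hom ≫ mul X) ≫ Δ[X]
        = (β_ X X).hom ≫ (mul X ≫ Δ[X]) ≫ (β_ X X).inv := by
          conv_lhs => rw [← h]
          simp [SymmetricCategory.braiding_swap_eq_inv_braiding]
      _ ≤ (β_ X X).hom ≫ 𝟙 _ ≫ (β_ X X).inv :=
          comp_mono le_rfl (comp_mono (mul_copy_le X) le_rfl)
      _ = 𝟙 _ := by simp

theorem whiskerLeft_unit_mul (X : B) : X ◁ unit X ≫ mul X = (ρ_ X).hom := by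
  have h : Δ[X] ≫ X ◁ ε[X] = (ρ_ X).inv := ComonObj.comul_counit X
  refine le_antisymm ?_ ?_
  · rw [← id_tensorHom]; exact unit_mul_right_le X
  -- The units of `Δ ⊣ mul` and `ε ⊣ unit` are inserted in turn; the counit law then cancels `Δ`
  -- against `ε`.
  · calc (ρ_ X).hom = (ρ_ X).hom ≫ 𝟙 X := by simp
      _ ≤ (ρ_ X).hom ≫ Δ[X] ≫ mul X := comp_mono le_rfl (le_copy_mul X)
      _ = (ρ_ X).hom ≫ Δ[X] ≫ X ◁ 𝟙 X ≫ mul X := by simp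
      _ ≤ (ρ_ X).hom ≫ Δ[X] ≫ X ◁ (ε[X] ≫ unit X) ≫ mul X :=
          comp_mono le_rfl (comp_mono le_rfl
            (comp_mono (whiskerLeft_mono X (le_discard_unit X)) le_rfl))
      _ = (ρ_ X).hom ≫ (Δ[X] ≫ X ◁ ε[X]) ≫ X ◁ unit X ≫ mul X := by simp
      _ = X ◁ unit X ≫ mul X := by rw [h]; simp

theorem unit_whiskerRight_mul (X : B) : unit X ▷ X ≫ mul X = (λ_ X).hom := by
  rw [← braiding_mul, BraidedCategory.braiding_naturality_left_assoc, whiskerLeft_unit_mul]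
  simp

theorem tensorμ_tensorμ (X Y Z W : B) : tensorμ X Y Z W ≫ tensorμ X Z Y W = 𝟙 _ := by
  have h : tensorδ X Y Z W = tensorμ X Z Y W := by
    simp [tensorδ, tensorμ, SymmetricCategory.braiding_swap_eq_inv_braiding]
  rw [← h, tensorμ_tensorδ]

/-- Coherence is assumed only for `Δ`; it passes to `mul` because the right-hand side is also right
adjoint to the comultiplication of `X ⊗ Y`. -/
theorem mul_tensor (X Y : B) :
    mul (X ⊗ Y) = tensorμ X Y X Y ≫ (mul X ⊗ₘ mul Y) := by
  refine rightAdjoint_unique (le_copy_mul _) (mul_copy_le _) ?_ ?_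
  · rw [CopyDiscardCategory.copy_tensor]
    calc 𝟙 (X ⊗ Y) = (𝟙 X ⊗ₘ 𝟙 Y) := by simp
      _ ≤ ((Δ[X] ≫ mul X) ⊗ₘ (Δ[Y] ≫ mul Y)) := tensor_mono (le_copy_mul X) (le_copy_mul Y)
      _ = _ := by simp [reassoc_of% tensorμ_tensorμ]
  · rw [CopyDiscardCategory.copy_tensor]
    calc (tensorμ X Y X Y ≫ (mul X ⊗ₘ mul Y)) ≫ (Δ[X] ⊗ₘ Δ[Y]) ≫ tensorμ X X Y Y
        = tensorμ X Y X Y ≫ ((mul X ≫ Δ[X]) ⊗ₘ (mul Y ≫ Δ[Y])) ≫ tensorμ X X Y Y := by simp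
      _ ≤ tensorμ X Y X Y ≫ (𝟙 (X ⊗ X) ⊗ₘ 𝟙 (Y ⊗ Y)) ≫ tensorμ X X Y Y :=
          comp_mono le_rfl (comp_mono (tensor_mono (mul_copy_le X) (mul_copy_le Y)) le_rfl)
      _ = 𝟙 _ := by simp [tensorμ_tensorμ]

/-! ### Snake equations -/

/-- The Frobenius law turns the zigzag into `mul ≫ Δ` with a `unit` plugged in and an `ε` at one
output; the unit and counit laws remove both. -/
theorem snake_right (Y : B) :
    (ρ_ Y).inv ≫ Y ◁ (unit Y ≫ Δ[Y]) ≫ (α_ Y Y Y).inv ≫ (mul Y ≫ ε[Y]) ▷ Y ≫ (λ_ Y).hom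
      = 𝟙 Y := by
  have h : Δ[Y] ≫ ε[Y] ▷ Y = (λ_ Y).inv := ComonObj.counit_comul Y
  have hf := frobenius_right Y
  calc _ = (ρ_ Y).inv ≫ Y ◁ unit Y ≫ (Y ◁ Δ[Y] ≫ (α_ Y Y Y).inv ≫ mul Y ▷ Y) ≫ ε[Y] ▷ Y ≫
        (λ_ Y).hom := by simp
    _ = (ρ_ Y).inv ≫ (Y ◁ unit Y ≫ mul Y) ≫ (Δ[Y] ≫ ε[Y] ▷ Y) ≫ (λ_ Y).hom := by
        rw [hf]; simp
    _ = 𝟙 Y := by rw [h, whiskerLeft_unit_mul]; simp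

theorem snake_left (Y : B) :
    (λ_ Y).inv ≫ (unit Y ≫ Δ[Y]) ▷ Y ≫ (α_ Y Y Y).hom ≫ Y ◁ (mul Y ≫ ε[Y]) ≫ (ρ_ Y).hom
      = 𝟙 Y := by
  have h : Δ[Y] ≫ Y ◁ ε[Y] = (ρ_ Y).inv := ComonObj.comul_counit Y
  have hf := frobenius_left Y
  calc _ = (λ_ Y).inv ≫ unit Y ▷ Y ≫ (Δ[Y] ▷ Y ≫ (α_ Y Y Y).hom ≫ Y ◁ mul Y) ≫ Y ◁ ε[Y] ≫
        (ρ_ Y).hom := by simp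
    _ = (λ_ Y).inv ≫ (unit Y ▷ Y ≫ mul Y) ≫ (Δ[Y] ≫ Y ◁ ε[Y]) ≫ (ρ_ Y).hom := by
        rw [hf]; simp
    _ = 𝟙 Y := by rw [h, unit_whiskerRight_mul]; simp

theorem counitHom_counitInvHom {X Y : MapCat B} (T : X.obj ⟶ Y.obj) :
    counitHom (counitInvHom T) = T := by
  change (ρ_ X.obj).inv ≫ X.obj ◁ (unit Y.obj ≫ Δ[Y.obj]) ≫ (α_ X.obj Y.obj Y.obj).inv ≫
    (T ▷ Y.obj ≫ mul Y.obj ≫ ε[Y.obj]) ▷ Y.obj ≫ (λ_ Y.obj).hom = T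
  calc _ = T ≫ (ρ_ Y.obj).inv ≫ Y.obj ◁ (unit Y.obj ≫ Δ[Y.obj]) ≫ (α_ Y.obj Y.obj Y.obj).inv ≫
        (mul Y.obj ≫ ε[Y.obj]) ▷ Y.obj ≫ (λ_ Y.obj).hom := by
        rw [comp_whiskerRight, Category.assoc, ← associator_inv_naturality_left_assoc,
          whisker_exchange_assoc, ← rightUnitor_inv_naturality_assoc]
    _ = T := by rw [snake_right, Category.comp_id]

theorem counitInvHom_counitHom {X Y : MapCat B} (R : (doctrine B).obj (op (X ⊗ Y))) :
    counitInvHom (counitHom R) = R := by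
  change X.obj ⊗ Y.obj ⟶ 𝟙_ B at R
  change ((ρ_ X.obj).inv ≫ X.obj ◁ (unit Y.obj ≫ Δ[Y.obj]) ≫ (α_ X.obj Y.obj Y.obj).inv ≫
    R ▷ Y.obj ≫ (λ_ Y.obj).hom) ▷ Y.obj ≫ mul Y.obj ≫ ε[Y.obj] = R
  generalize X.obj = X at *
  generalize Y.obj = Y at *
  calc _ = X ◁ ((λ_ Y).inv ≫ (unit Y ≫ Δ[Y]) ▷ Y ≫ (α_ Y Y Y).hom) ≫ (α_ _ _ _).inv ≫
        R ▷ (Y ⊗ Y) ≫ 𝟙_ B ◁ (mul Y ≫ ε[Y]) ≫ (λ_ _).hom := by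
        simp
    -- The interchange law slides the cap past `R`, isolating a snake on the `Y` wire.
    _ = X ◁ ((λ_ Y).inv ≫ (unit Y ≫ Δ[Y]) ▷ Y ≫ (α_ Y Y Y).hom ≫ Y ◁ (mul Y ≫ ε[Y]) ≫
          (ρ_ Y).hom) ≫ R := by
        rw [← whisker_exchange_assoc]; simp [unitors_equal]
    _ = R := by rw [snake_left]; simp

end CartesianBicategory

/-! ### Pairings in a cartesian category as composites of structural morphisms -/

section

open CartesianMonoidalCategory

variable {C : Type u} [Category.{v} C] [CartesianMonoidalCategory C]

theorem lift_whiskerLeft_fst_snd (X A : C) :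
    lift (X ◁ fst A A) (snd X (A ⊗ A)) =
      X ◁ (diagonal A ▷ A ≫ (α_ A A A).hom) ≫ (α_ X A (A ⊗ A)).inv := by
  ext <;> simp

theorem lift_snd_id [BraidedCategory C] (X A : C) :
    lift (snd X A) (𝟙 (X ⊗ A)) =
      X ◁ diagonal A ≫ (α_ X A A).inv ≫ (β_ X A).hom ▷ A ≫ (α_ A X A).hom := by
  ext <;> simp

end

namespace CartesianBicategory

open CartesianMonoidalCategory

variable {B : Type u} [Category.{v} B] [MonoidalCategory.{v} B] [CartesianBicategory B]

/-! ### The doctrine of a cartesian bicategory -/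

theorem fst_hom (X Y : MapCat B) : (fst X Y).hom = X.obj ◁ ε[Y.obj] ≫ (ρ_ X.obj).hom := rfl

theorem snd_hom (X Y : MapCat B) : (snd X Y).hom = ε[X.obj] ▷ Y.obj ≫ (λ_ Y.obj).hom := rfl

theorem lift_hom {W X Y : MapCat B} (f : W ⟶ X) (g : W ⟶ Y) :
    (lift f g).hom = Δ[W.obj] ≫ (f.hom ⊗ₘ g.hom) := rfl

theorem diagonal_hom (X : MapCat B) : (diagonal X).hom = Δ[X.obj] := by
  change Δ[X.obj] ≫ (𝟙 X.obj ⊗ₘ 𝟙 X.obj) = _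
  simp

/-- Reduces each meet of two reindexed predicates to a pairing, which the `lift_…` lemmas rewrite as
an explicit diagram. -/
theorem inf_eq_lift {W X Y : MapCat B} (f : W ⟶ X) (g : W ⟶ Y) (U : X.obj ⟶ 𝟙_ B)
    (V : Y.obj ⟶ 𝟙_ B) :
    (f.hom ≫ U) ⊓ (g.hom ≫ V) = (lift f g).hom ≫ (U ⊗ₘ V) ≫ (λ_ (𝟙_ B)).hom := by
  rw [inf_def, lift_hom, mul_tensorUnit]
  simp

/-- The equality predicate of the doctrine of a cartesian bicategory. -/
def eqPred (A : B) : A ⊗ A ⟶ 𝟙_ B := mul A ≫ ε[A]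

/-- The right adjoint of the second projection. -/
def sndAdj (X A : B) : A ⟶ X ⊗ A := (λ_ A).inv ≫ unit X ▷ A

/-- The right adjoint of the first projection. -/
def fstAdj (A X : B) : A ⟶ A ⊗ X := (ρ_ A).inv ≫ A ◁ unit X

theorem gc_sndAdj (X A : MapCat B) (Z : B) :
    GaloisConnection (fun U : (X ⊗ A).obj ⟶ Z => sndAdj X.obj A.obj ≫ U)
      (fun V : A.obj ⟶ Z => (snd X A).hom ≫ V) := by
  refine gc_of_adj (f := (snd X A).hom) (g := sndAdj X.obj A.obj) ?_ ?_ Z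
  · rw [snd_hom, sndAdj]
    change 𝟙 (X.obj ⊗ A.obj) ≤ _
    calc 𝟙 (X.obj ⊗ A.obj) = 𝟙 X.obj ▷ A.obj := by simp
      _ ≤ (ε[X.obj] ≫ unit X.obj) ▷ A.obj := whiskerRight_mono (le_discard_unit _) _
      _ = _ := by simp
  · rw [snd_hom, sndAdj]
    calc _ = (λ_ A.obj).inv ≫ (unit X.obj ≫ ε[X.obj]) ▷ A.obj ≫ (λ_ A.obj).hom := by simp
      _ ≤ (λ_ A.obj).inv ≫ 𝟙 _ ▷ A.obj ≫ (λ_ A.obj).hom :=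
        comp_mono le_rfl (comp_mono (whiskerRight_mono (unit_discard_le _) _) le_rfl)
      _ = 𝟙 _ := by simp

theorem gc_fstAdj (A X : MapCat B) (Z : B) :
    GaloisConnection (fun U : (A ⊗ X).obj ⟶ Z => fstAdj A.obj X.obj ≫ U)
      (fun V : A.obj ⟶ Z => (fst A X).hom ≫ V) := by
  refine gc_of_adj (f := (fst A X).hom) (g := fstAdj A.obj X.obj) ?_ ?_ Z
  · rw [fst_hom, fstAdj]
    change 𝟙 (A.obj ⊗ X.obj) ≤ _
    calc 𝟙 (A.obj ⊗ X.obj) = A.obj ◁ 𝟙 X.obj := by simp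
      _ ≤ A.obj ◁ (ε[X.obj] ≫ unit X.obj) := whiskerLeft_mono _ (le_discard_unit _)
      _ = _ := by simp
  · rw [fst_hom, fstAdj]
    calc _ = (ρ_ A.obj).inv ≫ A.obj ◁ (unit X.obj ≫ ε[X.obj]) ≫ (ρ_ A.obj).hom := by simp
      _ ≤ (ρ_ A.obj).inv ≫ A.obj ◁ 𝟙 _ ≫ (ρ_ A.obj).hom :=
        comp_mono le_rfl (comp_mono (whiskerLeft_mono _ (unit_discard_le _)) le_rfl)
      _ = 𝟙 _ := by simp

/-- One copy of the first `A` is fed to the cap together with the second. The Frobenius law rewrites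
this as multiplying, then copying and discarding one copy, which is just `mul`. -/
theorem fst_inf_eqPred (X A : MapCat B) (α : (X ⊗ A).obj ⟶ 𝟙_ B) :
    ((X ◁ fst A A).hom ≫ α) ⊓ ((snd X (A ⊗ A)).hom ≫ eqPred A.obj) =
      X.obj ◁ mul A.obj ≫ α := by
  have e' := congrArg (fun t => t.hom) (lift_whiskerLeft_fst_snd X A)
  have h : Δ[A.obj] ≫ A.obj ◁ ε[A.obj] = (ρ_ A.obj).inv := ComonObj.comul_counit A.obj
  change (lift (X ◁ fst A A) (snd X (A ⊗ A))).hom =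
    X.obj ◁ ((diagonal A).hom ▷ A.obj ≫ (α_ A.obj A.obj A.obj).hom) ≫
      (α_ X.obj A.obj (A.obj ⊗ A.obj)).inv at e'
  rw [inf_eq_lift, e', diagonal_hom]
  clear e'
  change X.obj ⊗ A.obj ⟶ 𝟙_ B at α
  change (X.obj ◁ (Δ[A.obj] ▷ A.obj ≫ (α_ A.obj A.obj A.obj).hom) ≫
      (α_ X.obj A.obj (A.obj ⊗ A.obj)).inv) ≫ (α ⊗ₘ (mul A.obj ≫ ε[A.obj])) ≫ _ = _
  generalize X.obj = X at *
  generalize A.obj = A at *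
  calc _ = X ◁ ((Δ[A] ▷ A ≫ (α_ A A A).hom ≫ A ◁ mul A) ≫ A ◁ ε[A] ≫ (ρ_ A).hom) ≫ α := by
        rw [tensorHom_def']
        simp [unitors_equal]
    _ = X ◁ (mul A ≫ (Δ[A] ≫ A ◁ ε[A]) ≫ (ρ_ A).hom) ≫ α := by
        rw [frobenius_left]; simp
    _ = _ := by rw [h]; simp

theorem gc_eqPred (X A : MapCat B) :
    GaloisConnection
      (fun α : (X ⊗ A).obj ⟶ 𝟙_ B =>
        ((X ◁ fst A A).hom ≫ α) ⊓ ((snd X (A ⊗ A)).hom ≫ eqPred A.obj))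
      (fun β : (X ⊗ A ⊗ A).obj ⟶ 𝟙_ B => (X ◁ diagonal A).hom ≫ β) := by
  simp only [fst_inf_eqPred]
  refine gc_of_adj (f := (X ◁ diagonal A).hom) (g := X.obj ◁ mul A.obj) ?_ ?_ _
  · change 𝟙 (X.obj ⊗ A.obj) ≤ X.obj ◁ (diagonal A).hom ≫ _
    rw [diagonal_hom, ← MonoidalCategory.whiskerLeft_comp]
    simpa using whiskerLeft_mono X.obj (le_copy_mul A.obj)
  · change X.obj ◁ mul A.obj ≫ X.obj ◁ (diagonal A).hom ≤ 𝟙 (X.obj ⊗ A.obj ⊗ A.obj)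
    rw [diagonal_hom, ← MonoidalCategory.whiskerLeft_comp]
    simpa using whiskerLeft_mono X.obj (mul_copy_le A.obj)

/-- Copying `A` and plugging `unit` into `X` act on different tensor factors, so they commute by
interchange; the rest is naturality of the braiding. -/
theorem sndAdj_frobenius (X A : MapCat B) (U : A.obj ⟶ 𝟙_ B) (V : (X ⊗ A).obj ⟶ 𝟙_ B) :
    sndAdj X.obj A.obj ≫ (((snd X A).hom ≫ U) ⊓ V) = U ⊓ (sndAdj X.obj A.obj ≫ V) := by
  have e' := congrArg (fun t => t.hom) (lift_snd_id X A)
  change (lift (snd X A) (𝟙 (X ⊗ A))).hom =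
    X.obj ◁ (diagonal A).hom ≫ (α_ X.obj A.obj A.obj).inv ≫ (β_ X.obj A.obj).hom ▷ A.obj ≫
      (α_ A.obj X.obj A.obj).hom at e'
  have hi := inf_eq_lift (snd X A) (𝟙 (X ⊗ A)) U V
  rw [e', diagonal_hom, show (𝟙 (X ⊗ A) : X ⊗ A ⟶ X ⊗ A).hom ≫ V = V from
    Category.id_comp V] at hi
  rw [hi, inf_def, mul_tensorUnit, sndAdj]
  clear hi e'
  change X.obj ⊗ A.obj ⟶ 𝟙_ B at V
  change ((λ_ A.obj).inv ≫ unit X.obj ▷ A.obj) ≫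
    (X.obj ◁ Δ[A.obj] ≫ (α_ X.obj A.obj A.obj).inv ≫ (β_ X.obj A.obj).hom ▷ A.obj ≫
      (α_ A.obj X.obj A.obj).hom) ≫ (U ⊗ₘ V) ≫ _ = _
  generalize X.obj = X at *
  generalize A.obj = A at *
  calc _ = (λ_ A).inv ≫ (unit X ▷ A ≫ X ◁ Δ[A]) ≫ (α_ X A A).inv ≫ (β_ X A).hom ▷ A ≫
      (α_ A X A).hom ≫ (U ⊗ₘ V) ≫ (λ_ _).hom := by simp
    _ = Δ[A] ≫ (λ_ _).inv ≫ (α_ _ A A).inv ≫ (unit X ▷ A ≫ (β_ X A).hom) ▷ A ≫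
      (α_ A X A).hom ≫ (U ⊗ₘ V) ≫ (λ_ _).hom := by
        rw [← whisker_exchange]
        simp only [comp_whiskerRight, Category.assoc, leftUnitor_inv_naturality_assoc,
          associator_inv_naturality_left_assoc]
    _ = Δ[A] ≫ (λ_ _).inv ≫ (α_ _ A A).inv ≫ (β_ (𝟙_ B) A).hom ▷ A ≫ (α_ _ _ _).hom ≫
      A ◁ (unit X ▷ A) ≫ (U ⊗ₘ V) ≫ (λ_ _).hom := by
        rw [BraidedCategory.braiding_naturality_left]; simp
    _ = _ := by
        simp only [tensorHom_def', braiding_tensorUnit_left]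
        simp

theorem sndAdj_naturality (X : B) {A A' : B} (f : A' ⟶ A) :
    sndAdj X A' ≫ X ◁ f = f ≫ sndAdj X A := by
  rw [sndAdj, Category.assoc, ← whisker_exchange]
  simp [sndAdj]

end CartesianBicategory

/-! ### Pairings used in the composition and tensor of relations -/

section

open CartesianMonoidalCategory

variable {C : Type u} [Category.{v} C] [CartesianMonoidalCategory C]

theorem lift_relComp [BraidedCategory C] (X Y Z : C) :
    lift (lift (snd Y (X ⊗ Z) ≫ fst X Z) (fst Y (X ⊗ Z)))
        (lift (fst Y (X ⊗ Z)) (snd Y (X ⊗ Z) ≫ snd X Z)) =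
      diagonal Y ▷ (X ⊗ Z) ≫ (α_ (Y ⊗ Y) X Z).inv ≫ (β_ (Y ⊗ Y) X).hom ▷ Z ≫
        (α_ X Y Y).inv ▷ Z ≫ (α_ (X ⊗ Y) Y Z).hom := by
  ext <;> simp

theorem lift_fst_fst_snd_snd [BraidedCategory C] (X X' Y Y' : C) :
    lift (fst X X' ⊗ₘ fst Y Y') (snd X X' ⊗ₘ snd Y Y') = tensorμ X X' Y Y' := by
  ext <;> simp [tensorμ]

end

/-! ### Generalities on elementary existential doctrines -/

section

variable {C : Type u'} [Category.{v'} C] {P : Cᵒᵖ ⥤ SemilatInfCat.{w}}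

theorem reindex_id {X : C} (U : P.obj (op X)) : reindex P (𝟙 X) U = U := by
  change P.map (𝟙 (op X)) U = U
  rw [P.map_id]
  rfl

theorem reindex_reindex {X Y Z : C} (f : X ⟶ Y) (g : Y ⟶ Z) (U : P.obj (op Z)) :
    reindex P f (reindex P g U) = reindex P (f ≫ g) U := by
  change P.map f.op (P.map g.op U) = P.map (g.op ≫ f.op) U
  rw [P.map_comp]
  rfl

theorem reindex_mono {X Y : C} (f : X ⟶ Y) {U V : P.obj (op Y)} (h : U ≤ V) :
    reindex P f U ≤ reindex P f V :=
  OrderHomClass.mono (reindex P f) h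

end

namespace ElementaryExistential

open CartesianMonoidalCategory

variable {C : Type u'} [Category.{v'} C] [CartesianMonoidalCategory C]
  {P : Cᵒᵖ ⥤ SemilatInfCat.{w}}

variable (S S' : ElementaryExistential P)

theorem δ_unique (A : C) : S.δ A = S'.δ A := by
  -- At the terminal object and at `⊤`, the left adjoint returns the equality predicate itself, up
  -- to a unitor.
  have h := (S.elementary (𝟙_ C) A).l_unique (S'.elementary (𝟙_ C) A) (fun _ => rfl) (b := ⊤)
  have h' := congrArg (reindex P (λ_ (A ⊗ A)).inv) h
  simp only [map_top, top_inf_eq] at h'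
  rwa [reindex_reindex, reindex_reindex, leftUnitor_inv_snd, reindex_id, reindex_id] at h'

theorem existsSnd_unique {X A : C} (U : P.obj (op (X ⊗ A))) :
    S.existsSnd X A U = S'.existsSnd X A U :=
  (S.gc_existsSnd X A).l_unique (S'.gc_existsSnd X A) (fun _ => rfl)

theorem top_le_reindex_diagonal (A : C) : ⊤ ≤ reindex P (diagonal A) (S.δ A) := by
  -- The parameter is taken to be `A` itself, so that reindexing along `diagonal A` can eliminate
  -- it.
  have h := (S.elementary A A).le_u_l ⊤
  have h' := reindex_mono (diagonal A) (h.trans (reindex_mono _ inf_le_right))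
  rwa [map_top, reindex_reindex, reindex_reindex, Category.assoc, whiskerLeft_snd, lift_snd_assoc,
    Category.id_comp] at h'

theorem reindex_lift_graph {Z X Y : C} (p : Z ⟶ X) (f : X ⟶ Y) (q : Z ⟶ Y) :
    reindex P (lift p q) (S.graph f) = reindex P (lift (p ≫ f) q) (S.δ Y) := by
  rw [graph, reindex_reindex]
  simp

theorem top_le_reindex_lift_self {Z A : C} (f : Z ⟶ A) :
    ⊤ ≤ reindex P (lift f f) (S.δ A) := by
  have h := reindex_mono f (S.top_le_reindex_diagonal A)
  rw [map_top, reindex_reindex] at h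
  simpa using h

/-- Substitution of equals for equals. -/
theorem graph_le {Z A : C} (g : Z ⟶ A) {U : P.obj (op (Z ⊗ A))}
    (hU : ⊤ ≤ reindex P (lift (𝟙 Z) g) U) : S.graph g ≤ U := by
  -- Transposed across the elementary adjunction this is trivial, since both projections restrict to
  -- the identity on the diagonal. It is then evaluated at `(z, a) ↦ (z, g z, a)`.
  have h : reindex P (Z ◁ fst A A) U ⊓ reindex P (snd Z (A ⊗ A)) (S.δ A) ≤
      reindex P (Z ◁ snd A A) U := by
    refine (S.elementary Z A).l_le ?_
    rw [reindex_reindex, ← MonoidalCategory.whiskerLeft_comp, lift_snd,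
      MonoidalCategory.whiskerLeft_id, reindex_id]
  have h₁ := reindex_mono (lift (fst Z A) (g ▷ A)) h
  have e₁ : lift (fst Z A) (g ▷ A) ≫ Z ◁ fst A A = fst Z A ≫ lift (𝟙 Z) g := by
    ext <;> simp
  have e₂ : lift (fst Z A) (g ▷ A) ≫ Z ◁ snd A A = 𝟙 _ := by
    ext <;> simp
  rw [map_inf, reindex_reindex, reindex_reindex, reindex_reindex, e₁, e₂, lift_snd, reindex_id,
    ← reindex_reindex, top_le_iff.mp hU, map_top, top_inf_eq] at h₁
  exact h₁

theorem top_le_reindex_lift_symm {Z A : C} {f g : Z ⟶ A}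
    (h : ⊤ ≤ reindex P (lift f g) (S.δ A)) : ⊤ ≤ reindex P (lift g f) (S.δ A) := by
  -- Substitution in the predicate `a = f z` of `(z, a)`, to be evaluated at `a = g z`.
  have h₁ : S.graph f ≤ reindex P (lift (snd Z A) (fst Z A ≫ f)) (S.δ A) := by
    refine S.graph_le f ?_
    rw [reindex_reindex]
    simpa using S.top_le_reindex_lift_self f
  have h₂ := reindex_mono (lift (𝟙 Z) g) h₁
  rw [reindex_lift_graph, Category.id_comp, reindex_reindex] at h₂
  simpa using h.trans h₂

theorem graph_le_graph {Z A : C} {f g : Z ⟶ A} (h : ⊤ ≤ reindex P (lift f g) (S.δ A)) :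
    S.graph g ≤ S.graph f := by
  refine S.graph_le g ?_
  rwa [reindex_lift_graph, Category.id_comp]

theorem graph_eq_graph {Z A : C} {f g : Z ⟶ A} (h : ⊤ ≤ reindex P (lift f g) (S.δ A)) :
    S.graph f = S.graph g :=
  le_antisymm (S.graph_le_graph (S.top_le_reindex_lift_symm h)) (S.graph_le_graph h)

theorem hasComprehensiveDiagonals_of_faithful
    (hS : ∀ {Z A : C} {f g : Z ⟶ A}, S.graph f = S.graph g → f = g) :
    S.HasComprehensiveDiagonals := by
  intro A
  refine ⟨S.top_le_reindex_diagonal A, fun Z h hh => ?_⟩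
  -- Provably equal morphisms have the same graph, so faithfulness makes them equal in `C`.
  have e : h ≫ fst A A = h ≫ snd A A := hS (S.graph_eq_graph (by simpa using hh))
  refine ⟨h ≫ fst A A, ?_, ?_⟩
  · ext
    · simp
    · simp [e]
  · rintro k rfl
    simp

theorem ruleOfUniqueChoice_of_full
    (hS : ∀ {X Y : C} {R : S.Rel X Y}, S.IsMap R → ∃ f : X ⟶ Y, S.graph f = R) :
    S.RuleOfUniqueChoice := by
  intro X Y R hR
  obtain ⟨f, rfl⟩ := hS hR
  refine ⟨f, ?_⟩
  rw [reindex_lift_graph, Category.id_comp]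
  exact S.top_le_reindex_lift_self f

end ElementaryExistential

/-! ### The elementary existential structure of `doctrine B` -/

namespace CartesianBicategory

open CartesianMonoidalCategory

variable {B : Type u} [Category.{v} B] [MonoidalCategory.{v} B] [CartesianBicategory B]

theorem sndAdj_beckChevalley {X A A' W Z : B} {k : X ⊗ A' ⟶ W} {f' : W ⟶ X ⊗ A} {f : A' ⟶ A}
    (h : k ≫ f' = X ◁ f) (β : X ⊗ A ⟶ Z) :
    sndAdj X A' ≫ k ≫ f' ≫ β = f ≫ sndAdj X A ≫ β := by
  rw [← Category.assoc k, h, ← Category.assoc, sndAdj_naturality, Category.assoc]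

variable (B) in
/-- The doctrine of a cartesian bicategory is elementary and existential. -/
def doctrineElementaryExistential : ElementaryExistential (doctrine B) where
  δ A := eqPred A.obj
  elementary X A := gc_eqPred X A
  existsFst A₁ A₂ := fun U => fstAdj A₁.obj A₂.obj ≫ U
  gc_existsFst A₁ A₂ := gc_fstAdj A₁ A₂ _
  existsSnd A₁ A₂ := fun U => sndAdj A₁.obj A₂.obj ≫ U
  gc_existsSnd A₁ A₂ := gc_sndAdj A₁ A₂ _
  beckChevalley {X A X' A'} f' π' f hp := by
    -- A pullback of a product projection is again one, up to the isomorphism `e` with inverse `k`.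
    -- The quantifier along `π'` is thus the one along `snd X A'`, transported, and Beck–Chevalley
    -- becomes naturality of `sndAdj`.
    let e : X' ⟶ X ⊗ A' := lift (f' ≫ fst X A) π'
    let k : X ⊗ A' ⟶ X' := hp.lift (snd X A') (X ◁ f) (by simp)
    have hk₁ : k ≫ π' = snd X A' := hp.lift_fst _ _ _
    have hk₂ : k ≫ f' = X ◁ f := hp.lift_snd _ _ _
    have hek : e ≫ k = 𝟙 X' := by
      apply hp.hom_ext
      · rw [Category.assoc, hk₁]; simp [e]
      · rw [Category.assoc, hk₂]
        ext1 <;> simp only [e, Category.assoc, whiskerLeft_fst, whiskerLeft_snd, lift_fst,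
          lift_snd_assoc, Category.id_comp, hp.w]
    have hke : k ≫ e = 𝟙 (X ⊗ A') := by
      ext1
      · simp [e, reassoc_of% hk₂]
      · simp [e, hk₁]
    have hek' : e.hom ≫ k.hom = 𝟙 X'.obj := congrArg (fun t => t.hom) hek
    have hke' : k.hom ≫ e.hom = 𝟙 (X ⊗ A').obj := congrArg (fun t => t.hom) hke
    have hk₁' : π'.hom = e.hom ≫ (snd X A').hom := by
      rw [← show k.hom ≫ π'.hom = (snd X A').hom from congrArg (fun t => t.hom) hk₁,
        ← Category.assoc, hek', Category.id_comp]
    refine ⟨fun U => sndAdj X.obj A'.obj ≫ k.hom ≫ U, ?_, fun β => ?_⟩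
    · have h := (gc_of_adj hek'.ge hke'.le (𝟙_ B)).compose (gc_sndAdj X A' (𝟙_ B))
      intro U V
      refine (h U V).trans ?_
      change U ≤ e.hom ≫ (snd X A').hom ≫ V ↔ U ≤ π'.hom ≫ V
      rw [hk₁']
      exact iff_of_eq (congrArg (U ≤ ·) (Category.assoc _ _ _).symm)
    · exact sndAdj_beckChevalley (k := k.hom) (congrArg (fun t => t.hom) hk₂) β
  frobenius X A α β := sndAdj_frobenius X A α β

/-! ### Bending as an isomorphism onto the relations of an arbitrary structure `S` -/

theorem δ_eq_eqPred (S : ElementaryExistential (doctrine B)) (A : MapCat B) :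
    S.δ A = eqPred A.obj :=
  S.δ_unique (doctrineElementaryExistential B) A

theorem existsSnd_eq (S : ElementaryExistential (doctrine B)) (X A : MapCat B)
    (U : (doctrine B).obj (op (X ⊗ A))) :
    S.existsSnd X A U = sndAdj X.obj A.obj ≫ U :=
  S.existsSnd_unique (doctrineElementaryExistential B) U

theorem counitInvHom_id (S : ElementaryExistential (doctrine B)) (X : MapCat B) :
    counitInvHom (𝟙 X.obj) = S.relId X := by
  rw [ElementaryExistential.relId, δ_eq_eqPred]
  change 𝟙 X.obj ▷ X.obj ≫ mul X.obj ≫ ε[X.obj] = _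
  simp [eqPred]

theorem graph_eq_counitInvHom (S : ElementaryExistential (doctrine B)) {X Y : MapCat B}
    (f : X ⟶ Y) : S.graph f = counitInvHom f.hom := by
  rw [ElementaryExistential.graph, δ_eq_eqPred]
  rfl

/-- Naturality of the braiding carries the cup across `X`, leaving a braiding with the tensor unit,
which consists of unitors. -/
theorem bend_whiskerRight_comp {X Y Z : B} (R : X ⊗ Y ⟶ 𝟙_ B) (V : Y ⊗ Z ⟶ 𝟙_ B) :
    sndAdj Y (X ⊗ Z) ≫ (Δ[Y] ▷ (X ⊗ Z) ≫ (α_ (Y ⊗ Y) X Z).inv ≫ (β_ (Y ⊗ Y) X).hom ▷ Z ≫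
        (α_ X Y Y).inv ▷ Z ≫ (α_ (X ⊗ Y) Y Z).hom) ≫ (R ⊗ₘ V) ≫ (λ_ (𝟙_ B)).hom =
      ((ρ_ X).inv ≫ X ◁ (unit Y ≫ Δ[Y]) ≫ (α_ X Y Y).inv ≫ R ▷ Y ≫ (λ_ Y).hom) ▷ Z ≫ V := by
  calc _ = (λ_ (X ⊗ Z)).inv ≫ (α_ _ X Z).inv ≫ ((unit Y ≫ Δ[Y]) ▷ X ≫ (β_ (Y ⊗ Y) X).hom) ▷ Z ≫
      (α_ X Y Y).inv ▷ Z ≫ (α_ (X ⊗ Y) Y Z).hom ≫ (R ⊗ₘ V) ≫ (λ_ (𝟙_ B)).hom := by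
        simp [sndAdj]
    _ = _ := by
      rw [BraidedCategory.braiding_naturality_left, MonoidalCategory.tensorHom_def,
        braiding_tensorUnit_left]
      simp

theorem relComp_eq (S : ElementaryExistential (doctrine B)) {X Y Z : MapCat B}
    (R : S.Rel X Y) (V : S.Rel Y Z) :
    S.relComp R V = counitHom R ▷ Z.obj ≫ (show Y.obj ⊗ Z.obj ⟶ 𝟙_ B from V) := by
  rw [ElementaryExistential.relComp, existsSnd_eq]
  have h := inf_eq_lift (lift (snd Y (X ⊗ Z) ≫ fst X Z) (fst Y (X ⊗ Z)))
    (lift (fst Y (X ⊗ Z)) (snd Y (X ⊗ Z) ≫ snd X Z)) R V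
  rw [lift_relComp, show (_ : (Y ⊗ X ⊗ Z : MapCat B) ⟶ (X ⊗ Y) ⊗ (Y ⊗ Z)).hom =
    (diagonal Y).hom ▷ (X.obj ⊗ Z.obj) ≫ (α_ (Y.obj ⊗ Y.obj) X.obj Z.obj).inv ≫
      (β_ (Y.obj ⊗ Y.obj) X.obj).hom ▷ Z.obj ≫ (α_ X.obj Y.obj Y.obj).inv ▷ Z.obj ≫
        (α_ (X.obj ⊗ Y.obj) Y.obj Z.obj).hom from rfl, diagonal_hom] at h
  exact (congrArg (fun t => sndAdj Y.obj (X ⊗ Z).obj ≫ t) h).trans (bend_whiskerRight_comp R V)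

theorem counitInvHom_comp (S : ElementaryExistential (doctrine B)) {X Y Z : MapCat B}
    (T : X.obj ⟶ Y.obj) (U : Y.obj ⟶ Z.obj) :
    counitInvHom (T ≫ U) = S.relComp (counitInvHom T) (counitInvHom U) := by
  rw [relComp_eq, counitHom_counitInvHom]
  change (T ≫ U) ▷ Z.obj ≫ _ = T ▷ Z.obj ≫ U ▷ Z.obj ≫ _
  simp

theorem counitInvHom_tensor (S : ElementaryExistential (doctrine B)) {X Y X' Y' : MapCat B}
    (T : X.obj ⟶ Y.obj) (U : X'.obj ⟶ Y'.obj) :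
    counitInvHom (X := X ⊗ X') (Y := Y ⊗ Y') (T ⊗ₘ U) =
      S.relTensor (counitInvHom T) (counitInvHom U) := by
  rw [ElementaryExistential.relTensor]
  have h := inf_eq_lift (fst X X' ⊗ₘ fst Y Y') (snd X X' ⊗ₘ snd Y Y') (counitInvHom T)
    (counitInvHom U)
  rw [lift_fst_fst_snd_snd] at h
  refine Eq.trans ?_ h.symm
  change (T ⊗ₘ U) ▷ (Y.obj ⊗ Y'.obj) ≫ mul (Y.obj ⊗ Y'.obj) ≫
    (CopyDiscardCategory.comonObj (Y.obj ⊗ Y'.obj)).counit =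
    tensorμ X.obj X'.obj Y.obj Y'.obj ≫
      ((T ▷ Y.obj ≫ mul Y.obj ≫ ε[Y.obj]) ⊗ₘ (U ▷ Y'.obj ≫ mul Y'.obj ≫ ε[Y'.obj])) ≫
        (λ_ (𝟙_ B)).hom
  rw [mul_tensor, CopyDiscardCategory.discard_tensor, Category.assoc, tensorμ_natural_left_assoc]
  simp

theorem counitInvHom_le_iff {X Y : MapCat B} (T T' : X.obj ⟶ Y.obj) :
    counitInvHom T ≤ counitInvHom T' ↔ T ≤ T' := by
  constructor
  · intro h
    rw [← counitHom_counitInvHom T, ← counitHom_counitInvHom T']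
    exact comp_mono le_rfl (comp_mono le_rfl (comp_mono le_rfl
      (comp_mono (whiskerRight_mono h _) le_rfl)))
  · intro h
    exact comp_mono (whiskerRight_mono h _) le_rfl

theorem counitInvHom_injective {X Y : MapCat B} :
    Function.Injective (counitInvHom : (X.obj ⟶ Y.obj) → _) := fun T T' h => by
  rw [← counitHom_counitInvHom T, ← counitHom_counitInvHom T', h]

/-- Bending is injective and preserves every ingredient of the homomorphism equations: composition,
tensor and the graphs of the comonoid maps. -/
theorem isMap_counitInvHom_iff (S : ElementaryExistential (doctrine B)) {X Y : MapCat B}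
    (T : X.obj ⟶ Y.obj) : S.IsMap (counitInvHom T) ↔ maps B T := by
  rw [ElementaryExistential.IsMap, graph_eq_counitInvHom, graph_eq_counitInvHom,
    graph_eq_counitInvHom, graph_eq_counitInvHom, ← counitInvHom_tensor, ← counitInvHom_comp,
    ← counitInvHom_comp, ← counitInvHom_comp, counitInvHom_injective.eq_iff,
    counitInvHom_injective.eq_iff, diagonal_hom, diagonal_hom]
  exact ⟨fun h => ⟨h.2, h.1⟩, fun h => ⟨h.hom_comul, h.hom_counit⟩⟩

theorem graph_injective (S : ElementaryExistential (doctrine B)) {X Y : MapCat B}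
    {f g : X ⟶ Y} (h : S.graph f = S.graph g) : f = g := by
  rw [graph_eq_counitInvHom, graph_eq_counitInvHom] at h
  ext
  exact counitInvHom_injective h

theorem isMap_graph (S : ElementaryExistential (doctrine B)) {X Y : MapCat B} (f : X ⟶ Y) :
    S.IsMap (S.graph f) := by
  rw [graph_eq_counitInvHom, isMap_counitInvHom_iff]
  exact f.property

theorem exists_graph_eq (S : ElementaryExistential (doctrine B)) {X Y : MapCat B}
    {R : S.Rel X Y} (hR : S.IsMap R) : ∃ f : X ⟶ Y, S.graph f = R := by
  rw [← counitInvHom_counitHom R, isMap_counitInvHom_iff] at hR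
  refine ⟨⟨counitHom R, hR⟩, ?_⟩
  rw [graph_eq_counitInvHom]
  exact counitInvHom_counitHom R

end CartesianBicategory

theorem mainTheorem6 (B : Type u) [Category.{v} B] [MonoidalCategory.{v} B]
    [CartesianBicategory B] :
    -- `R(B)` is an elementary existential doctrine
    Nonempty (ElementaryExistential (CartesianBicategory.doctrine B)) ∧
    ∀ S : ElementaryExistential (CartesianBicategory.doctrine B),
      S.HasComprehensiveDiagonals ∧ S.RuleOfUniqueChoice ∧
      -- `ε_B⁻¹ : B → A_{R(B)}` is an isomorphism of cartesian bicategories, inverse to `ε_B`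
      (∀ X Y : CartesianBicategory.MapCat B,
        (∀ T : X.obj ⟶ Y.obj,
          CartesianBicategory.counitHom (CartesianBicategory.counitInvHom T) = T) ∧
        (∀ R : S.Rel X Y,
          CartesianBicategory.counitInvHom (CartesianBicategory.counitHom R) = R) ∧
        (∀ T T' : X.obj ⟶ Y.obj,
          CartesianBicategory.counitInvHom T ≤ CartesianBicategory.counitInvHom T' ↔ T ≤ T')) ∧
      (∀ X : CartesianBicategory.MapCat B,
        CartesianBicategory.counitInvHom (𝟙 X.obj) = S.relId X) ∧
      (∀ (X Y Z : CartesianBicategory.MapCat B) (T : X.obj ⟶ Y.obj) (U : Y.obj ⟶ Z.obj),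
        CartesianBicategory.counitInvHom (T ≫ U) =
          S.relComp (CartesianBicategory.counitInvHom T) (CartesianBicategory.counitInvHom U)) ∧
      (∀ (X Y X' Y' : CartesianBicategory.MapCat B) (T : X.obj ⟶ Y.obj) (U : X'.obj ⟶ Y'.obj),
        CartesianBicategory.counitInvHom (X := X ⊗ X') (Y := Y ⊗ Y') (T ⊗ₘ U) =
          S.relTensor (CartesianBicategory.counitInvHom T)
            (CartesianBicategory.counitInvHom U)) ∧
      -- the graph functor `Γ_{R(B)}` is the restriction of `ε_B⁻¹` to maps
      (∀ (X Y : CartesianBicategory.MapCat B) (f : X ⟶ Y),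
        S.graph f = CartesianBicategory.counitInvHom f.hom) ∧
      -- and it is full and faithful as a functor from `Map(B)` to `Map(A_{R(B)})`
      (∀ X Y : CartesianBicategory.MapCat B,
        Set.BijOn (fun f : X ⟶ Y => S.graph f) Set.univ {R : S.Rel X Y | S.IsMap R}) := by
  refine ⟨⟨CartesianBicategory.doctrineElementaryExistential B⟩,
    fun S => ⟨?_, ?_, ?_, ?_, ?_, ?_, ?_, ?_⟩⟩
  · exact S.hasComprehensiveDiagonals_of_faithful (CartesianBicategory.graph_injective S)
  · exact S.ruleOfUniqueChoice_of_full (CartesianBicategory.exists_graph_eq S)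
  · exact fun X Y => ⟨CartesianBicategory.counitHom_counitInvHom,
      CartesianBicategory.counitInvHom_counitHom, CartesianBicategory.counitInvHom_le_iff⟩
  · exact CartesianBicategory.counitInvHom_id S
  · exact fun _ _ _ => CartesianBicategory.counitInvHom_comp S
  · exact fun _ _ _ _ => CartesianBicategory.counitInvHom_tensor S
  · exact fun _ _ => CartesianBicategory.graph_eq_counitInvHom S
  · exact fun X Y => ⟨fun f _ => CartesianBicategory.isMap_graph S f,
      fun _ _ _ _ h => CartesianBicategory.graph_injective S h,
      fun R hR => (CartesianBicategory.exists_graph_eq S hR).imp fun _ h => ⟨trivial, h⟩⟩
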